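/- Let $V$ be a right quaternionic Hilbert space with a Hilbert basis $\mathcal O=(\phi_k)_k$, that is, an orthonormal family with $\langle\phi,\psi\rangle=\sum_k\langle\phi,\phi_k\rangle\langle\phi_k,\psi\rangle$ (absolutely convergent) for all $\phi,\psi\in V$. Let $\mathcal B(V)$ be the algebra of bounded right $\mathbb H$-linear operators on $V$, with identity $I_V$. For $p\in\mathbb H$, the symbol $p$ also denotes the operator $\phi\mapsto p\,\phi=\sum_k\phi_k\,p\,\langle\phi_k,\phi\rangle$ (left multiplication induced by $\mathcal O$), and for $A\in\mathcal B(V)$, $A\,p$ is the composition of $A$ with this operator. For $T\in\mathcal B(V)$ and $q\in\mathbb H$ put $\mathcal Q_q(T)=T^2-2\,\mathrm{Re}(q)\,T+|q|^2 I_V$. The $S$-spectrum is $\sigma_S(T)=\{q\in\mathbb H:\ \mathcal Q_q(T)\text{ is not invertible in }\mathcal B(V)\}$, and $T$ is called quasi-nilpotent if $\sigma_S(T)=\{0\}$. Let $\mathbb S$ be the set of imaginary units of $\mathbb H$, $[q]=\mathrm{Re}(q)+\mathbb S\,|\mathrm{Im}(q)|$, and $[A]=\bigcup_{a\in A}[a]$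 for $A\subset\mathbb H$. We say that $[q]$ is an isolated $2$-sphere of $\sigma_S(T)$ if $[q]\subset\sigma_S(T)$ and both $[q]$ and $\sigma_S(T)\setminus[q]$ are closed in $\sigma_S(T)$. (If $q$ is real, $[q]=\{q\}$.) Let $[q]$ be an isolated $2$-sphere of $\sigma_S(T)$, and let $P_{[q]}$ be the associated Riesz projection $$P_{[q]}=\frac1{2\pi}\int_{\partial([B(q,\varepsilon)]\cap\mathbb C_I)}S_L^{-1}(p,T)\,dp_I,\qquad S_L^{-1}(p,T)=-\mathcal Q_p(T)^{-1}(T-\overline p\,I_V),\quad dp_I=-dp\,I,$$ where $I\in\mathbb S$ is arbitrary, $\mathbb C_I=\mathbb R+I\mathbb R$, and $\varepsilon>0$ is any number with $[\overline B(q,\varepsilon)]\cap\sigma_S(T)=[q]$ and, if $q\notin\mathbb R$, $\varepsilon<|\mathrm{Im}(q)|$ (so that the positively oriented contour consists of the circles of radius $\varepsilon$ in $\mathbb C_I$ about the points $\mathrm{Re}(q)\pm I|\mathrm{Im}(q)|$). Then: 1. $\mathcal Q_q(T)+P_{[q]}$ and $\mathcal Q_q(T)+[2T+(1-2\,\mathrm{Re}(q))I_V]P_{[q]}$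 are invertible in $\mathcal B(V)$; 2. $\mathcal Q_q(T)P_{[q]}$ and $\mathcal Q_q(T)[2T+(1-2\,\mathrm{Re}(q))I_V]P_{[q]}$ are quasi-nilpotent. -/

import Mathlib

open scoped Quaternion

set_option linter.unusedSectionVars false

namespace QuatOp

/-! ### Right quaternionic Hilbert spaces -/

/-- A right quaternionic inner product on a normed space `V` whose quaternionic scalars act
on the right (`MulOpposite.op a • x` is `x a`): the `ℍ`-valued form `inner ℍ x y` is additive and
right linear in the second variable, Hermitian, and induces the norm.
A right quaternionic Hilbert space is such a `V` that is complete. The real structure of `V`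
is the restriction of the quaternionic one, which is what `IsScalarTower ℝ ℍᵐᵒᵖ V` says. -/
class RightInnerProductSpace (V : Type*) [NormedAddCommGroup V] [Module ℍ[ℝ]ᵐᵒᵖ V]
    extends Inner ℍ[ℝ] V where
  qinner_add_right : ∀ x y z : V, inner x (y + z) = inner x y + inner x z
  qinner_smul_right : ∀ (x y : V) (a : ℍ[ℝ]), inner x (MulOpposite.op a • y) = inner x y * a
  star_qinner : ∀ x y : V, star (inner x y) = inner y x
  qinner_self : ∀ x : V, inner x x = ((‖x‖ ^ 2 : ℝ) : ℍ[ℝ])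

/-- `𝓑(V)`: the bounded right `ℍ`-linear operators on `V`, as a real subalgebra of the Banach
algebra of bounded real linear operators (so with composition and the operator norm). -/
def rightLinearOperators (V : Type*) [NormedAddCommGroup V] [NormedSpace ℝ V]
    [Module ℍ[ℝ]ᵐᵒᵖ V] [IsScalarTower ℝ ℍ[ℝ]ᵐᵒᵖ V] : Subalgebra ℝ (V →L[ℝ] V) where
  carrier := {T | ∀ (a : ℍ[ℝ]) (x : V), T (MulOpposite.op a • x) = MulOpposite.op a • T x}
  mul_mem' := by
    intro S T hS hT a x
    simp only [Set.mem_ofPred_eq] at hS hT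
    simp [hS, hT]
  add_mem' := by
    intro S T hS hT a x
    simp only [Set.mem_ofPred_eq] at hS hT
    simp [hS, hT]
  algebraMap_mem' := by
    intro r a x
    simp only [Algebra.algebraMap_eq_smul_one, smul_apply,
      one_apply_eq_self]
    rw [← smul_one_smul ℍ[ℝ]ᵐᵒᵖ r (MulOpposite.op a • x), ← smul_one_smul ℍ[ℝ]ᵐᵒᵖ r x,
      smul_smul, smul_smul]
    congr 1
    simp

/-- `𝓑(V)` as a type. -/
abbrev BddOp (V : Type*) [NormedAddCommGroup V] [NormedSpace ℝ V]
    [Module ℍ[ℝ]ᵐᵒᵖ V] [IsScalarTower ℝ ℍ[ℝ]ᵐᵒᵖ V] : Type _ :=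
  ↥(rightLinearOperators V)

/-! ### Hilbert bases and the left multiplication they induce -/

/-- A Hilbert basis of a right quaternionic Hilbert space: an orthonormal family `φ` with
`⟨x, y⟩ = ∑ ⟨x, φ k⟩ ⟨φ k, y⟩` (absolutely convergent) for all `x`, `y`. -/
structure QuatHilbertBasis (ι V : Type*) [NormedAddCommGroup V] [Module ℍ[ℝ]ᵐᵒᵖ V]
    [RightInnerProductSpace V] where
  vec : ι → V
  inner_vec_self : ∀ k, inner ℍ[ℝ] (vec k) (vec k) = 1
  inner_vec_of_ne : ∀ k l, k ≠ l → inner ℍ[ℝ] (vec k) (vec l) = 0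
  hasSum_inner_mul_inner : ∀ x y : V,
    HasSum (fun k => inner ℍ[ℝ] x (vec k) * inner ℍ[ℝ] (vec k) y) (inner ℍ[ℝ] x y)

section LeftMul

variable {ι V : Type*} [NormedAddCommGroup V] [NormedSpace ℝ V]
  [Module ℍ[ℝ]ᵐᵒᵖ V] [IsScalarTower ℝ ℍ[ℝ]ᵐᵒᵖ V] [RightInnerProductSpace V]

open RightInnerProductSpace

theorem norm_op_smul (a : ℍ[ℝ]) (x : V) : ‖MulOpposite.op a • x‖ = ‖a‖ * ‖x‖ := by
  have h : inner ℍ[ℝ] (MulOpposite.op a • x) (MulOpposite.op a • x)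
      = (((‖a‖ * ‖x‖) ^ 2 : ℝ) : ℍ[ℝ]) := by
    rw [qinner_smul_right, ← star_qinner, qinner_smul_right, qinner_self, star_mul,
      Quaternion.star_coe, mul_assoc, Quaternion.coe_commutes, ← mul_assoc,
      Quaternion.star_mul_self, Quaternion.normSq_eq_norm_mul_self]
    norm_cast
    ring_nf
  rw [qinner_self] at h
  have h2 : ‖MulOpposite.op a • x‖ ^ 2 = (‖a‖ * ‖x‖) ^ 2 := Quaternion.coe_injective h
  exact (sq_eq_sq₀ (norm_nonneg _) (by positivity)).1 h2

theorem op_real_smul (r : ℝ) (a : ℍ[ℝ]) (x : V) :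
    MulOpposite.op (r • a) • x = r • (MulOpposite.op a • x) := by
  rw [MulOpposite.op_smul, smul_assoc]

theorem inner_real_smul_right (r : ℝ) (x y : V) :
    inner ℍ[ℝ] x (r • y) = r • inner ℍ[ℝ] x y := by
  have h := qinner_smul_right x y (r : ℍ[ℝ])
  have h2 : MulOpposite.op (r : ℍ[ℝ]) • y = r • y := by
    have := op_real_smul r 1 y
    rw [MulOpposite.op_one, one_smul] at this
    rw [← this]
    congr 2
    ext <;> simp
  rw [h2] at h
  rw [h, ← Quaternion.coe_commutes, Quaternion.coe_mul_eq_smul]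

variable (V) in
/-- The real inner product space underlying a right quaternionic one. -/
abbrev realInner : InnerProductSpace ℝ V where
  inner x y := (inner ℍ[ℝ] x y).re
  norm_sq_eq_re_inner x := by
    rw [qinner_self]
    rfl
  conj_inner_symm x y := by
    simp only [conj_trivial]
    rw [← star_qinner x y, Quaternion.re_star]
  add_left x y z := by
    rw [← star_qinner z, ← star_qinner z, ← star_qinner z, qinner_add_right]
    simp
  smul_left x y r := by
    rw [← star_qinner y, ← star_qinner y, inner_real_smul_right]
    simp

/-- `a ↦ φ a`, for a unit vector `φ`. -/
noncomputable def smulIsometry (φ : V) (h : inner ℍ[ℝ] φ φ = 1) : ℍ[ℝ] →ₗᵢ[ℝ] V where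
  toFun a := MulOpposite.op a • φ
  map_add' a b := by rw [MulOpposite.op_add, add_smul]
  map_smul' r a := op_real_smul r a φ
  norm_map' a := by
    have h1 : ‖φ‖ ^ 2 = 1 := by
      rw [qinner_self] at h
      exact Quaternion.coe_injective (h.trans Quaternion.coe_one.symm)
    have h2 : ‖φ‖ = 1 := by nlinarith [norm_nonneg φ]
    change ‖MulOpposite.op a • φ‖ = ‖a‖
    rw [norm_op_smul, h2, mul_one]

theorem QuatHilbertBasis.orthogonalFamily (b : QuatHilbertBasis ι V) :
    letI := realInner V
    OrthogonalFamily ℝ (fun _ : ι => ℍ[ℝ])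
      (fun k => smulIsometry (b.vec k) (b.inner_vec_self k)) := by
  intro k l hkl v w
  change (inner ℍ[ℝ] (MulOpposite.op v • b.vec k) (MulOpposite.op w • b.vec l)).re = 0
  rw [qinner_smul_right, ← star_qinner, qinner_smul_right, b.inner_vec_of_ne l k hkl.symm]
  simp

theorem QuatHilbertBasis.hasSum_norm_sq (b : QuatHilbertBasis ι V) (x : V) :
    HasSum (fun k => ‖inner ℍ[ℝ] (b.vec k) x‖ ^ 2) (‖x‖ ^ 2) := by
  have h := b.hasSum_inner_mul_inner x x
  rw [qinner_self] at h
  have h2 : ∀ k, inner ℍ[ℝ] x (b.vec k) * inner ℍ[ℝ] (b.vec k) x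
      = ((‖inner ℍ[ℝ] (b.vec k) x‖ ^ 2 : ℝ) : ℍ[ℝ]) := by
    intro k
    rw [← star_qinner (b.vec k) x, Quaternion.star_mul_self, Quaternion.normSq_eq_norm_mul_self,
      sq]
  simp only [h2] at h
  exact Quaternion.hasSum_coe.1 h

theorem QuatHilbertBasis.summable_leftMul [CompleteSpace V] (b : QuatHilbertBasis ι V)
    (q : ℍ[ℝ]) (x : V) :
    Summable fun k => MulOpposite.op (q * inner ℍ[ℝ] (b.vec k) x) • b.vec k := by
  let _ := realInner V
  refine (b.orthogonalFamily.summable_iff_norm_sq_summable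
    (fun k => q * inner ℍ[ℝ] (b.vec k) x)).2 ?_
  simp only [norm_mul, mul_pow]
  exact (b.hasSum_norm_sq x).summable.mul_left _

theorem QuatHilbertBasis.norm_leftMul_le [CompleteSpace V] (b : QuatHilbertBasis ι V)
    (q : ℍ[ℝ]) (x : V) :
    ‖∑' k, MulOpposite.op (q * inner ℍ[ℝ] (b.vec k) x) • b.vec k‖ ≤ ‖q‖ * ‖x‖ := by
  let _ := realInner V
  refine le_of_tendsto (b.summable_leftMul q x).hasSum.norm (Filter.Eventually.of_forall ?_)
  intro s
  have h : ‖∑ k ∈ s, MulOpposite.op (q * inner ℍ[ℝ] (b.vec k) x) • b.vec k‖ ^ 2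
      = ∑ k ∈ s, ‖q * inner ℍ[ℝ] (b.vec k) x‖ ^ 2 :=
    b.orthogonalFamily.norm_sum (fun k => q * inner ℍ[ℝ] (b.vec k) x) s
  refine abs_le_of_sq_le_sq' ?_ (by positivity) |>.2
  rw [h]
  simp only [norm_mul, mul_pow]
  rw [← Finset.mul_sum]
  gcongr
  exact sum_le_hasSum s (fun _ _ => by positivity) (b.hasSum_norm_sq x)

/-- The left multiplication by the quaternion `q` that a Hilbert basis `φ` induces, as an operator:
`q x = ∑ φ k q ⟨φ k, x⟩`. -/
noncomputable def QuatHilbertBasis.leftMul [CompleteSpace V] (b : QuatHilbertBasis ι V)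
    (q : ℍ[ℝ]) : BddOp V :=
  ⟨LinearMap.mkContinuous
    { toFun := fun x => ∑' k, MulOpposite.op (q * inner ℍ[ℝ] (b.vec k) x) • b.vec k
      map_add' := fun x y => by
        rw [← (b.summable_leftMul q x).tsum_add (b.summable_leftMul q y)]
        simp only [qinner_add_right, mul_add, MulOpposite.op_add, add_smul]
      map_smul' := fun r x => by
        rw [RingHom.id_apply, ← (b.summable_leftMul q x).tsum_const_smul]
        simp only [inner_real_smul_right, mul_smul_comm, op_real_smul] }
    ‖q‖ (b.norm_leftMul_le q),
  by
    intro a x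
    have hc : Continuous fun y : V => MulOpposite.op a • y :=
      (AddMonoidHomClass.continuous_of_bound
        (DistribSMul.toAddMonoidHom V (MulOpposite.op a)) ‖a‖
        (fun y => (norm_op_smul a y).le))
    change ∑' k, MulOpposite.op (q * inner ℍ[ℝ] (b.vec k) (MulOpposite.op a • x)) • b.vec k
      = MulOpposite.op a • ∑' k, MulOpposite.op (q * inner ℍ[ℝ] (b.vec k) x) • b.vec k
    have hm := (b.summable_leftMul q x).map_tsum
      (DistribSMul.toAddMonoidHom V (MulOpposite.op a)) hc
    rw [DistribSMul.toAddMonoidHom_apply] at hm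
    rw [hm]
    simp only [qinner_smul_right, ← mul_assoc, MulOpposite.op_mul, smul_smul,
      DistribSMul.toAddMonoidHom_apply]⟩

end LeftMul

/-! ### Two-spheres in the quaternions -/

/-- The sphere `𝕊` of imaginary units. -/
def imagUnits : Set ℍ[ℝ] := {I | I.re = 0 ∧ star I * I = 1}

/-- The 2-sphere `[q] = Re q + 𝕊 |Im q|` (the single point `q` if `q` is real). -/
def sphere (q : ℍ[ℝ]) : Set ℍ[ℝ] :=
  {p | ∃ J ∈ imagUnits, p = (q.re : ℍ[ℝ]) + J * ((‖q.im‖ : ℝ) : ℍ[ℝ])}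

/-- The axially symmetric set `[A]`, the union of the spheres `[a]`, `a ∈ A`. -/
def axialHull (A : Set ℍ[ℝ]) : Set ℍ[ℝ] := ⋃ a ∈ A, sphere a

/-- The point `x + I y` of the complex plane `ℂ_I = ℝ + I ℝ`, for `z = x + i y`. -/
noncomputable def slicePoint (I : ℍ[ℝ]) (z : ℂ) : ℍ[ℝ] := (z.re : ℍ[ℝ]) + I * (z.im : ℍ[ℝ])

section Spectrum

variable {ι V : Type*} [NormedAddCommGroup V] [NormedSpace ℝ V]
  [Module ℍ[ℝ]ᵐᵒᵖ V] [IsScalarTower ℝ ℍ[ℝ]ᵐᵒᵖ V]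

/-- `𝒬_q(T) = T² - 2 Re(q) T + |q|² 𝕀`. -/
noncomputable def pseudo (q : ℍ[ℝ]) (T : BddOp V) : BddOp V :=
  T ^ 2 - (2 * q.re) • T + (‖q‖ ^ 2) • (1 : BddOp V)

/-- The `S`-spectrum: the `q` for which `𝒬_q(T)` is not invertible in `𝓑(V)`. -/
def sSpectrum (T : BddOp V) : Set ℍ[ℝ] := {q | ¬ IsUnit (pseudo q T)}

/-- `T` is quasi-nilpotent if its `S`-spectrum is `{0}`. -/
def IsQuasiNilpotent (T : BddOp V) : Prop := sSpectrum T = {0}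

/-- `[q]` is an isolated 2-sphere of `σ_S(T)`: it is a subset of `σ_S(T)`, and both `[q]` and
`σ_S(T) \ [q]` are closed in `σ_S(T)`. -/
def IsIsolatedSphere (T : BddOp V) (q : ℍ[ℝ]) : Prop :=
  sphere q ⊆ sSpectrum T ∧
    IsClosed (Subtype.val ⁻¹' sphere q : Set (sSpectrum T)) ∧
    IsClosed (Subtype.val ⁻¹' (sSpectrum T \ sphere q) : Set (sSpectrum T))

/-! ### The Riesz projection -/

variable [RightInnerProductSpace V] [CompleteSpace V]

/-- The left `S`-resolvent operator `S_L⁻¹(p, T) = - 𝒬_p(T)⁻¹ (T - p̄ 𝕀)`, where `p̄ 𝕀` is the left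
multiplication by `p̄` that the Hilbert basis induces (`Ring.inverse` is the inverse, for
`p ∉ σ_S(T)`). -/
noncomputable def leftSResolvent (b : QuatHilbertBasis ι V) (p : ℍ[ℝ]) (T : BddOp V) : BddOp V :=
  -(Ring.inverse (pseudo p T) * (T - b.leftMul (star p)))

/-- `∫ S_L⁻¹(p, T) dp_I`, `dp_I = - dp I`, over the positively oriented circle of `ℂ_I` with
center `c` and radius `r`. An operator times a quaternion on the right is the operator composed
with the left multiplication by that quaternion. -/
noncomputable def sResolventCircleIntegral (b : QuatHilbertBasis ι V) (T : BddOp V) (I : ℍ[ℝ])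
    (c : ℂ) (r : ℝ) : BddOp V :=
  ∫ θ in (0 : ℝ)..(2 * Real.pi),
    leftSResolvent b (slicePoint I (circleMap c r θ)) T *
      b.leftMul (-(slicePoint I (deriv (circleMap c r) θ)) * I)

/-- The radii `ε > 0` for which `[B(q, ε)]` is a domain of integration for the Riesz projection of
`[q]`: its closure `[B̄(q, ε)]` meets `σ_S(T)` in `[q]` only, and, for `q` not real, it does not meet
the real line, so that the boundary of `[B(q, ε)] ∩ ℂ_I` is two disjoint circles. -/
def IsSeparatingRadius (T : BddOp V) (q : ℍ[ℝ]) (ε : ℝ) : Prop :=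
  0 < ε ∧ (q.im ≠ 0 → ε < ‖q.im‖) ∧
    axialHull (Metric.closedBall q ε) ∩ sSpectrum T = sphere q

/-- The Riesz projection `P_[q] = (1 / 2π) ∫_{∂([B(q, ε)] ∩ ℂ_I)} S_L⁻¹(p, T) dp_I`, for an imaginary
unit `I` and a separating radius `ε`. The boundary of `[B(q, ε)] ∩ ℂ_I` consists of the circles of
radius `ε` about the points of `[q] ∩ ℂ_I`, that is, `Re q ± I |Im q|` (a single circle if `q` is
real, since the two-element set below is then a singleton). -/
noncomputable def rieszProjection (b : QuatHilbertBasis ι V) (T : BddOp V) (q I : ℍ[ℝ]) (ε : ℝ) :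
    BddOp V :=
  (1 / (2 * Real.pi)) •
    ∑ c ∈ ({⟨q.re, ‖q.im‖⟩, ⟨q.re, -‖q.im‖⟩} : Finset ℂ), sResolventCircleIntegral b T I c ε

end Spectrum

end QuatOp

/-! Everything takes place in the bicommutant of `T`, a commutative real Banach algebra closed under
inverses. Right multiplication by ℂ_I makes `V` a complex Banach space and 𝓑(V) an algebra of
complex-linear operators with the same notion of invertibility. Gelfand theory then shows that an
element of the bicommutant is invertible exactly when no continuous real character χ into ℂ kills it
(`exists_character_apply_eq_zero`, `character_apply_ne_zero`).

The Riesz projection is built from left multiplications, which need not commute with `T`. Pairing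
conjugate points of the contour removes them: 𝒬_p(T) is the same at both points, and left
multiplications by u and ū add up to the real scalar 2 Re u (`sResolventCircleIntegral_add_conj`).
So P lies in the bicommutant, and χ(P) is a sum of scalar Cauchy integrals, equal to 1 if χ(T) is
one of the points c, c̄ of [q] in the plane and to 0 otherwise (`exists_character_rieszProjection`).

Since χ(𝒬_q(T)) = (c - χ(T))(c̄ - χ(T)), exactly one of 𝒬_q(T) and P vanishes at each character:
their sum is invertible, and their product is killed by every character, hence quasi-nilpotent. The
factor 2T + 1 - 2 Re q changes nothing, having the value 1 ± 2i Im c where P is 1. -/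

namespace QuatOp

/-! ### Complex planes inside the quaternions -/

section Slice

theorem imagUnit_mul_self {I : ℍ[ℝ]} (hI : I ∈ imagUnits) : I * I = -1 := by
  have h : star I = -I := by
    have := hI.1
    ext <;> simp [this]
  have h2 := hI.2
  rw [h, neg_mul] at h2
  rw [← h2, neg_neg]

/-- `x + i y ↦ x + I y`, as a homomorphism of real algebras. -/
noncomputable def sliceHom {I : ℍ[ℝ]} (hI : I ∈ imagUnits) : ℂ →ₐ[ℝ] ℍ[ℝ] :=
  Complex.liftAux I (imagUnit_mul_self hI)

theorem sliceHom_apply {I : ℍ[ℝ]} (hI : I ∈ imagUnits) (z : ℂ) :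
    sliceHom hI z = slicePoint I z := by
  rw [sliceHom, Complex.liftAux_apply, slicePoint, ← Quaternion.coe_commutes,
    Quaternion.coe_mul_eq_smul, Quaternion.algebraMap_def]

theorem slicePoint_I {I : ℍ[ℝ]} : slicePoint I Complex.I = I := by
  simp [slicePoint]

theorem slicePoint_re {I : ℍ[ℝ]} (hI : I ∈ imagUnits) (z : ℂ) : (slicePoint I z).re = z.re := by
  have := hI.1
  simp [slicePoint, this]

theorem star_slicePoint {I : ℍ[ℝ]} (hI : I ∈ imagUnits) (z : ℂ) :
    star (slicePoint I z) = slicePoint I (starRingEnd ℂ z) := by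
  have := hI.1
  ext <;> simp [slicePoint, this, mul_comm]

theorem norm_slicePoint {I : ℍ[ℝ]} (hI : I ∈ imagUnits) (z : ℂ) : ‖slicePoint I z‖ = ‖z‖ := by
  have h : ((‖slicePoint I z‖ * ‖slicePoint I z‖ : ℝ) : ℍ[ℝ]) = ((‖z‖ * ‖z‖ : ℝ) : ℍ[ℝ]) := by
    rw [← Quaternion.normSq_eq_norm_mul_self, ← Quaternion.star_mul_self, star_slicePoint hI,
      ← sliceHom_apply hI, ← sliceHom_apply hI, ← map_mul, Complex.conj_mul', ← Complex.ofReal_pow,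
      sq]
    exact (sliceHom hI).commutes _
  exact (mul_self_inj (norm_nonneg _) (norm_nonneg _)).1 (Quaternion.coe_injective h)

theorem continuous_slicePoint (I : ℍ[ℝ]) : Continuous (slicePoint I) := by
  unfold slicePoint
  have h := Quaternion.continuous_coe
  fun_prop

theorem slicePoint_im {I : ℍ[ℝ]} (z : ℂ) (hI : I ∈ imagUnits) :
    (slicePoint I z).im = I * (z.im : ℍ[ℝ]) := by
  have := hI.1
  ext <;> simp [slicePoint, this]

theorem norm_imagUnit {I : ℍ[ℝ]} (hI : I ∈ imagUnits) : ‖I‖ = 1 := by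
  rw [← slicePoint_I (I := I), norm_slicePoint hI, Complex.norm_I]

theorem neg_mem_imagUnits {I : ℍ[ℝ]} (hI : I ∈ imagUnits) : -I ∈ imagUnits := by
  refine ⟨by simp [hI.1], ?_⟩
  rw [star_neg, neg_mul_neg, hI.2]

/-- Every quaternion lies in a complex plane `ℂ_J`, in the closed upper half plane. -/
theorem exists_eq_slicePoint (q : ℍ[ℝ]) {I : ℍ[ℝ]} (hI : I ∈ imagUnits) :
    ∃ J ∈ imagUnits, q = slicePoint J ⟨q.re, ‖q.im‖⟩ := by
  by_cases h : q.im = 0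
  · refine ⟨I, hI, ?_⟩
    rw [slicePoint, h]
    conv_lhs => rw [← Quaternion.re_add_im q, h]
    simp
  · have hn : ‖q.im‖ ≠ 0 := norm_ne_zero_iff.2 h
    refine ⟨(‖q.im‖⁻¹ : ℝ) • q.im, ⟨by simp, ?_⟩, ?_⟩
    · rw [Quaternion.star_mul_self, Quaternion.normSq_eq_norm_mul_self, norm_smul, norm_inv,
        norm_norm, inv_mul_cancel₀ hn]
      simp
    · rw [slicePoint, ← Quaternion.coe_commutes, Quaternion.coe_mul_eq_smul, smul_smul,
        mul_inv_cancel₀ hn, one_smul, Quaternion.re_add_im]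

theorem slicePoint_mem_sphere_iff {I : ℍ[ℝ]} (hI : I ∈ imagUnits) (q : ℍ[ℝ]) (z : ℂ) :
    slicePoint I z ∈ sphere q ↔ z.re = q.re ∧ |z.im| = ‖q.im‖ := by
  constructor
  · rintro ⟨J, hJ, h⟩
    have h' : slicePoint I z = slicePoint J ⟨q.re, ‖q.im‖⟩ := h
    constructor
    · have := congrArg (fun x : ℍ[ℝ] => x.re) h'
      simpa only [slicePoint_re hI, slicePoint_re hJ] using this
    · have := congrArg (fun x : ℍ[ℝ] => ‖x.im‖) h'
      simpa [slicePoint_im z hI, slicePoint_im _ hJ, norm_imagUnit hI, norm_imagUnit hJ] using this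
  · rintro ⟨h1, h2⟩
    rcases abs_choice z.im with h3 | h3
    · exact ⟨I, hI, by rw [slicePoint, h1, ← h2, h3]⟩
    -- `sphere` uses the nonnegative number ‖Im q‖, so a point of the lower half plane needs the
    -- opposite unit.
    · refine ⟨-I, neg_mem_imagUnits hI, ?_⟩
      rw [slicePoint, h1, ← h2, h3]
      simp

end Slice

/-! ### Completeness of 𝓑(V), and left multiplication as an algebra homomorphism -/

section LeftMul

variable {ι V : Type*} [NormedAddCommGroup V] [NormedSpace ℝ V]
  [Module ℍ[ℝ]ᵐᵒᵖ V] [IsScalarTower ℝ ℍ[ℝ]ᵐᵒᵖ V] [RightInnerProductSpace V]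

open RightInnerProductSpace

theorem continuous_op_smul (a : ℍ[ℝ]) : Continuous fun y : V => MulOpposite.op a • y :=
  AddMonoidHomClass.continuous_of_bound (DistribSMul.toAddMonoidHom V (MulOpposite.op a)) ‖a‖
    (fun y => (norm_op_smul a y).le)

instance [CompleteSpace V] : CompleteSpace (BddOp V) := by
  suffices hcl : IsClosed (rightLinearOperators V : Set (V →L[ℝ] V)) from hcl.completeSpace_coe
  have h : (rightLinearOperators V : Set (V →L[ℝ] V))
      = ⋂ (a : ℍ[ℝ]) (x : V), {T | T (MulOpposite.op a • x) = MulOpposite.op a • T x} := by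
    ext T
    simp only [Set.mem_iInter]
    rfl
  rw [h]
  refine isClosed_iInter fun a => isClosed_iInter fun x => isClosed_eq (by fun_prop) ?_
  exact (continuous_op_smul a).comp (by fun_prop)

/-- An operator in `𝓑(V)` that is bijective with bounded inverse is invertible in `𝓑(V)`. -/
theorem isUnit_of_inverse (X : BddOp V) (Y : V →L[ℝ] V) (h1 : ∀ x, X.1 (Y x) = x)
    (h2 : ∀ x, Y (X.1 x) = x) : IsUnit X := by
  have hY : Y ∈ rightLinearOperators V := by
    intro a x
    conv_lhs => rw [← h1 x, ← X.2 a (Y x)]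
    rw [h2]
  refine ⟨⟨X, ⟨Y, hY⟩, ?_, ?_⟩, rfl⟩
  · ext x
    exact h1 x
  · ext x
    exact h2 x

namespace QuatHilbertBasis

variable (b : QuatHilbertBasis ι V)

theorem norm_inner_vec_le (k : ι) (x : V) : ‖inner ℍ[ℝ] (b.vec k) x‖ ≤ ‖x‖ := by
  refine abs_le_of_sq_le_sq' ?_ (norm_nonneg x) |>.2
  exact le_hasSum (b.hasSum_norm_sq x) k fun _ _ => by positivity

/-- The coordinate `x ↦ ⟨φ k, x⟩`. -/
noncomputable def coord (k : ι) : V →L[ℝ] ℍ[ℝ] :=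
  LinearMap.mkContinuous
    { toFun := fun x => inner ℍ[ℝ] (b.vec k) x
      map_add' := qinner_add_right _
      map_smul' := fun r x => inner_real_smul_right r _ x } 1
    (fun x => by simpa using b.norm_inner_vec_le k x)

theorem coord_apply (k : ι) (x : V) : b.coord k x = inner ℍ[ℝ] (b.vec k) x := rfl

/-- Parseval: the norm of x - y is determined by its coordinates. -/
theorem ext_coord {x y : V} (h : ∀ k, b.coord k x = b.coord k y) : x = y := by
  have h1 := b.hasSum_norm_sq (x - y)
  have h2 : ∀ k, inner ℍ[ℝ] (b.vec k) (x - y) = 0 := fun k => by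
    rw [← b.coord_apply, map_sub, h, sub_self]
  simp only [h2, norm_zero, ne_eq, OfNat.ofNat_ne_zero, not_false_eq_true, zero_pow] at h1
  have h3 := h1.unique hasSum_zero
  exact sub_eq_zero.1 (norm_eq_zero.1 (pow_eq_zero_iff two_ne_zero |>.1 h3))

variable [CompleteSpace V]

/-- By orthonormality only the k-th term of the series survives. Algebraic identities for `leftMul`
thus reduce to identities in ℍ, coordinate by coordinate. -/
theorem coord_leftMul (q : ℍ[ℝ]) (k : ι) (x : V) :
    b.coord k ((b.leftMul q).1 x) = q * b.coord k x := by
  change b.coord k (∑' l, MulOpposite.op (q * inner ℍ[ℝ] (b.vec l) x) • b.vec l) = _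
  rw [(b.coord k).map_tsum (b.summable_leftMul q x), tsum_eq_single k]
  · rw [coord_apply, qinner_smul_right, b.inner_vec_self, one_mul, coord_apply]
  · intro l hl
    rw [coord_apply, qinner_smul_right, b.inner_vec_of_ne k l hl.symm, zero_mul]

/-- The left multiplication induced by a Hilbert basis is a homomorphism of real algebras. -/
noncomputable def leftMulHom : ℍ[ℝ] →ₐ[ℝ] BddOp V :=
  AlgHom.ofLinearMap
    { toFun := b.leftMul
      map_add' := fun p q => by
        ext x
        refine b.ext_coord fun k => ?_
        change b.coord k _ = b.coord k ((b.leftMul p).1 x + (b.leftMul q).1 x)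
        rw [map_add, coord_leftMul, coord_leftMul, coord_leftMul, add_mul]
      map_smul' := fun r q => by
        ext x
        refine b.ext_coord fun k => ?_
        change b.coord k _ = b.coord k (r • (b.leftMul q).1 x)
        rw [map_smul, coord_leftMul, coord_leftMul, smul_mul_assoc] }
    (by
      ext x
      refine b.ext_coord fun k => ?_
      change b.coord k ((b.leftMul 1).1 x) = b.coord k x
      rw [coord_leftMul, one_mul])
    (fun p q => by
      ext x
      refine b.ext_coord fun k => ?_
      change b.coord k ((b.leftMul (p * q)).1 x) = b.coord k ((b.leftMul p).1 ((b.leftMul q).1 x))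
      rw [coord_leftMul, coord_leftMul, coord_leftMul, mul_assoc])

theorem leftMulHom_apply (q : ℍ[ℝ]) : b.leftMulHom q = b.leftMul q := rfl

theorem continuous_leftMulHom : Continuous b.leftMulHom :=
  LinearMap.continuous_of_finiteDimensional b.leftMulHom.toLinearMap

end QuatHilbertBasis

end LeftMul

end QuatOp

/-! ### Characters detect invertibility -/

/-- If a commutative subalgebra `B` of a real algebra `A` is represented in a complex Banach algebra
by a map that reflects invertibility, then the real characters `B → ℂ` detect invertibility. -/
theorem Subalgebra.exists_character_apply_eq_zero {A E : Type*} [NormedRing A] [NormedAlgebra ℝ A]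
    [NormedRing E] [NormedAlgebra ℂ E] [CompleteSpace E] (ρ : A →+* E) (hρc : Continuous ρ)
    (hρs : ∀ (r : ℝ) (a : A), ρ (r • a) = (r : ℂ) • ρ a)
    (hρu : ∀ a, IsUnit (ρ a) → IsUnit a) (B : Subalgebra ℝ A)
    (hB : ∀ x ∈ B, ∀ y ∈ B, x * y = y * x) (x : B) (hx : ¬ IsUnit (x : A)) :
    ∃ χ : B →ₐ[ℝ] ℂ, Continuous χ ∧ χ x = 0 := by
  let S : Set E := ρ '' B
  -- The bicommutant of the image is closed, commutative and complex, so Gelfand theory applies to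
  -- it.
  let C : Subalgebra ℂ E := Subalgebra.centralizer ℂ S.centralizer
  have hC : ∀ y : B, ρ y ∈ C := fun y => Set.subset_centralizer_centralizer ⟨y, y.2, rfl⟩
  have hS : ∀ u ∈ S, ∀ v ∈ S, u * v = v * u := by
    rintro _ ⟨u, hu, rfl⟩ _ ⟨v, hv, rfl⟩
    rw [← map_mul, hB u hu v hv, map_mul]
  have hcomm : ∀ u v : C, u * v = v * u := fun u v =>
    Subtype.ext (Set.centralizer_centralizer_comm_of_comm hS u.1 u.2 v.1 v.2)
  let _ : NormedCommRing C := { (inferInstance : NormedRing C) with mul_comm := hcomm }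
  have : CompleteSpace C :=
    (show IsClosed (C : Set E) from Set.isClosed_centralizer _).completeSpace_coe
  have hxC : ¬ IsUnit (⟨ρ x, hC x⟩ : C) := fun h =>
    hx (hρu _ (h.map (Subalgebra.val C)))
  obtain ⟨φ, hφ⟩ := WeakDual.CharacterSpace.exists_apply_eq_zero hxC
  have hφ1 : φ 1 = 1 := map_one φ
  let σ : B →+* C :=
    { toFun := fun y => ⟨ρ y, hC y⟩
      map_one' := Subtype.ext (map_one ρ)
      map_mul' := fun u v => Subtype.ext (map_mul ρ u.1 v.1)
      map_zero' := Subtype.ext (map_zero ρ)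
      map_add' := fun u v => Subtype.ext (map_add ρ u.1 v.1) }
  have hσ : Continuous σ := (hρc.comp continuous_subtype_val).subtype_mk _
  refine ⟨{ (WeakDual.CharacterSpace.toAlgHom φ).toRingHom.comp σ with
    commutes' := fun r => ?_ }, ?_, hφ⟩
  · change φ (σ (algebraMap ℝ B r)) = (r : ℂ)
    have h : σ (algebraMap ℝ B r) = (r : ℂ) • (1 : C) := by
      refine Subtype.ext ?_
      change ρ ((algebraMap ℝ B r : B) : A) = (r : ℂ) • (1 : E)
      rw [← map_one ρ, ← hρs, Algebra.algebraMap_eq_smul_one]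
      rfl
    rw [h, map_smul, hφ1, smul_eq_mul, mul_one]
  · exact (map_continuous φ).comp hσ

namespace QuatOp

variable {V : Type*} [NormedAddCommGroup V] [NormedSpace ℝ V]
  [Module ℍ[ℝ]ᵐᵒᵖ V] [IsScalarTower ℝ ℍ[ℝ]ᵐᵒᵖ V] [RightInnerProductSpace V]

variable (V) in
/-- The complex structure of a right quaternionic Hilbert space given by an imaginary unit. -/
noncomputable abbrev sliceNormedSpace {I : ℍ[ℝ]} (hI : I ∈ imagUnits) : NormedSpace ℂ V where
  smul z x := MulOpposite.op (sliceHom hI z) • x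
  one_smul x := by
    change MulOpposite.op (sliceHom hI 1) • x = x
    rw [map_one, MulOpposite.op_one, one_smul]
  mul_smul z w x := by
    change MulOpposite.op (sliceHom hI (z * w)) • x
      = MulOpposite.op (sliceHom hI z) • MulOpposite.op (sliceHom hI w) • x
    -- `op` reverses products; commutativity of ℂ makes this a left action all the same.
    rw [mul_comm, map_mul, MulOpposite.op_mul, mul_smul]
  smul_zero z := smul_zero (MulOpposite.op (sliceHom hI z))
  smul_add z x y := smul_add (MulOpposite.op (sliceHom hI z)) x y
  add_smul z w x := by
    change MulOpposite.op (sliceHom hI (z + w)) • x = _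
    rw [map_add, MulOpposite.op_add, add_smul]
    rfl
  zero_smul x := by
    change MulOpposite.op (sliceHom hI 0) • x = 0
    rw [map_zero, MulOpposite.op_zero, zero_smul]
  norm_smul_le z x := by
    change ‖MulOpposite.op (sliceHom hI z) • x‖ ≤ _
    rw [norm_op_smul, sliceHom_apply, norm_slicePoint hI]

/-- The characters of a commutative real subalgebra of `𝓑(V)` detect invertibility in `𝓑(V)`. -/
theorem exists_character_apply_eq_zero [CompleteSpace V] {I : ℍ[ℝ]} (hI : I ∈ imagUnits)
    (B : Subalgebra ℝ (BddOp V))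
    (hB : ∀ x ∈ B, ∀ y ∈ B, x * y = y * x) (x : B) (hx : ¬ IsUnit (x : BddOp V)) :
    ∃ χ : B →ₐ[ℝ] ℂ, Continuous χ ∧ χ x = 0 := by
  let _ := sliceNormedSpace V hI
  have hreal : ∀ (r : ℝ) (x : V), (r : ℂ) • x = r • x := by
    intro r x
    change MulOpposite.op (sliceHom hI (algebraMap ℝ ℂ r)) • x = r • x
    rw [AlgHom.commutes, Algebra.algebraMap_eq_smul_one, op_real_smul, MulOpposite.op_one, one_smul]
  let ρ : BddOp V →+* (V →L[ℂ] V) :=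
    { toFun := fun X =>
        { toFun := X.1
          map_add' := map_add X.1
          map_smul' := fun z y => X.2 (sliceHom hI z) y
          cont := X.1.continuous }
      map_one' := rfl
      map_mul' := fun _ _ => rfl
      map_zero' := rfl
      map_add' := fun _ _ => rfl }
  have hρ : ∀ X y, ρ X y = X.1 y := fun _ _ => rfl
  refine Subalgebra.exists_character_apply_eq_zero ρ ?_ ?_ ?_ B hB x hx
  · refine AddMonoidHomClass.continuous_of_bound ρ 1 fun X => ?_
    rw [one_mul]
    exact ContinuousLinearMap.opNorm_le_bound _ (norm_nonneg _) fun y => X.1.le_opNorm y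
  · intro r X
    ext y
    exact (hreal r _).symm
  · rintro X ⟨u, hu⟩
    have h1 : ∀ y, ρ X ((↑u⁻¹ : V →L[ℂ] V) y) = y := fun y => by
      rw [← hu, ← mul_apply_eq_comp, Units.mul_inv]
      rfl
    have h2 : ∀ y, (↑u⁻¹ : V →L[ℂ] V) (ρ X y) = y := fun y => by
      rw [← hu, ← mul_apply_eq_comp, Units.inv_mul]
      rfl
    -- The inverse is so far only ℂ_I-linear; `isUnit_of_inverse` recovers its right ℍ-linearity
    -- from that of X.
    let Y : V →L[ℝ] V :=
      { toFun := (↑u⁻¹ : V →L[ℂ] V)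
        map_add' := map_add _
        map_smul' := fun r y => by
          simp only [RingHom.id_apply]
          rw [← hreal, map_smul, hreal]
        cont := (↑u⁻¹ : V →L[ℂ] V).continuous }
    exact isUnit_of_inverse X Y h1 h2

/-! ### Cauchy integrals over a circle -/

open Real ComplexConjugate

/-- On the circle dz = i (z - c) dθ, and z - c is `circleMap 0 r θ`. -/
theorem integral_circleMap_div_sub {c w : ℂ} {r : ℝ} :
    ∫ θ in (0 : ℝ)..(2 * π), circleMap 0 r θ / (circleMap c r θ - w)
      = (∮ z in C(c, r), (z - w)⁻¹) / Complex.I := by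
  rw [circleIntegral, ← intervalIntegral.integral_div]
  congr 1
  ext θ
  simp only [deriv_circleMap, smul_eq_mul]
  field_simp

theorem integral_circleMap_div_sub_of_mem {c w : ℂ} {r : ℝ} (h : w ∈ Metric.ball c r) :
    ∫ θ in (0 : ℝ)..(2 * π), circleMap 0 r θ / (circleMap c r θ - w) = 2 * π := by
  rw [integral_circleMap_div_sub, circleIntegral.integral_sub_inv_of_mem_ball h]
  field_simp

theorem integral_circleMap_div_sub_of_notMem {c w : ℂ} {r : ℝ} (hr : 0 ≤ r)
    (h : w ∉ Metric.closedBall c r) :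
    ∫ θ in (0 : ℝ)..(2 * π), circleMap 0 r θ / (circleMap c r θ - w) = 0 := by
  have hd : ∀ z ∈ Metric.closedBall c r, DifferentiableAt ℂ (fun z => (z - w)⁻¹) z := by
    intro z hz
    refine DifferentiableAt.inv (by fun_prop) (sub_ne_zero.2 ?_)
    rintro rfl
    exact h hz
  rw [integral_circleMap_div_sub, Complex.circleIntegral_eq_zero_of_differentiable_on_off_countable
    hr Set.countable_empty (fun z hz => (hd z hz).continuousAt.continuousWithinAt)
    (fun z hz => hd z (Metric.ball_subset_closedBall hz.1)), zero_div]

theorem circleMap_conj (c : ℂ) (r θ : ℝ) :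
    circleMap (conj c) r (2 * π - θ) = conj (circleMap c r θ) := by
  simp only [circleMap, map_add, map_mul, Complex.conj_ofReal, ← Complex.exp_conj, Complex.conj_I]
  congr 2
  push_cast
  rw [show (2 * (π : ℂ) - θ) * Complex.I = θ * -Complex.I + 2 * π * Complex.I by ring,
    Complex.exp_periodic]

/-! ### The bicommutant and the paired resolvent -/

section Algebra

variable {A : Type*} [NormedRing A] [NormedAlgebra ℝ A]

theorem neg_mul_sub_mul {R : Type*} [Ring R] (k t a d : R) :
    -(k * (t - a)) * d = k * (a * d - t * d) := by
  noncomm_ring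

theorem mul_smul_one_eq (r : ℝ) (x : A) : x * r • (1 : A) = r • x := by
  rw [mul_smul_comm, mul_one]

/-- The bicommutant of an element. -/
abbrev bicommutant (T : A) : Subalgebra ℝ A :=
  Subalgebra.centralizer ℝ (Set.centralizer {T})

theorem self_mem_bicommutant (T : A) : T ∈ bicommutant T :=
  Set.subset_centralizer_centralizer rfl

theorem bicommutant_comm (T : A) : ∀ x ∈ bicommutant T, ∀ y ∈ bicommutant T, x * y = y * x :=
  Set.centralizer_centralizer_comm_of_comm (by rintro _ rfl _ rfl; rfl)

/-- An inverse commutes with whatever the element commutes with; for a non-unit, `Ring.inverse` is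
0. -/
theorem inverse_mem_bicommutant {T x : A} (hx : x ∈ bicommutant T) :
    Ring.inverse x ∈ bicommutant T := by
  by_cases h : IsUnit x
  · obtain ⟨u, rfl⟩ := h
    rw [Ring.inverse_unit]
    intro g hg
    exact (Commute.units_inv_right (hx g hg) :)
  · rw [Ring.inverse_non_unit _ h]
    exact zero_mem _

theorem character_apply_ne_zero {T : A} (x : bicommutant T) (h : IsUnit (x : A))
    (χ : bicommutant T →ₐ[ℝ] ℂ) : χ x ≠ 0 := by
  intro h0
  have h1 : x * ⟨Ring.inverse (x : A), inverse_mem_bicommutant x.2⟩ = 1 :=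
    Subtype.ext (Ring.mul_inverse_cancel _ h)
  have h2 := congrArg χ h1
  rw [map_mul, h0, zero_mul, map_one] at h2
  exact zero_ne_one h2

instance [CompleteSpace A] (T : A) : CompleteSpace (bicommutant T) :=
  (show IsClosed (bicommutant T : Set A) from Set.isClosed_centralizer _).completeSpace_coe

/-- `T² - 2 Re(z) T + |z|²`, which is `(T - z) (T - z̄)` if `z` acts on a space containing `T`. -/
noncomputable def quadratic (z : ℂ) (T : A) : A :=
  T ^ 2 - (2 * z.re) • T + (‖z‖ ^ 2) • (1 : A)

theorem quadratic_conj (z : ℂ) (T : A) : quadratic (conj z) T = quadratic z T := by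
  simp [quadratic]

theorem quadratic_mem_bicommutant (z : ℂ) {T X : A} (hX : X ∈ bicommutant T) :
    quadratic z X ∈ bicommutant T :=
  add_mem (sub_mem (pow_mem hX 2) (Subalgebra.smul_mem _ hX _))
    (Subalgebra.smul_mem _ (one_mem _) _)

/-- The real coefficients are z + z̄ and z z̄, so the polynomial splits once its argument is a
complex number. -/
theorem map_quadratic {B : Type*} [Ring B] [Algebra ℝ B] (χ : B →ₐ[ℝ] ℂ) (z : ℂ) (X : B) :
    χ (X ^ 2 - (2 * z.re) • X + (‖z‖ ^ 2) • (1 : B)) = (z - χ X) * (conj z - χ X) := by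
  have h1 : ((2 * z.re : ℝ) : ℂ) = z + conj z := (Complex.add_conj z).symm
  have h2 : ((‖z‖ ^ 2 : ℝ) : ℂ) = z * conj z := by
    rw [Complex.mul_conj']
    push_cast
    rfl
  rw [map_add, map_sub, map_pow, map_smul, map_smul, map_one, Complex.real_smul,
    Complex.real_smul, h1, h2]
  ring

theorem character_quadratic (z : ℂ) {T : A} (X : bicommutant T) (χ : bicommutant T →ₐ[ℝ] ℂ) :
    χ ⟨quadratic z X, quadratic_mem_bicommutant z X.2⟩ = (z - χ X) * (conj z - χ X) :=
  map_quadratic χ z X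

/-- At the values of the characters at `T`, the polynomial `quadratic` is not invertible. -/
theorem not_isUnit_quadratic_of_character {T : A} (χ : bicommutant T →ₐ[ℝ] ℂ) {z : ℂ}
    (hz : z = χ ⟨T, self_mem_bicommutant T⟩ ∨ conj z = χ ⟨T, self_mem_bicommutant T⟩) :
    ¬ IsUnit (quadratic z T) := by
  intro h
  refine character_apply_ne_zero ⟨_, quadratic_mem_bicommutant z (self_mem_bicommutant T)⟩ h χ ?_
  refine (character_quadratic z ⟨T, self_mem_bicommutant T⟩ χ).trans ?_
  rcases hz with hz | hz <;> simp [hz]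

/-- The real linear combination of `1` and `T`, over `quadratic z T`, that the resolvents at two
conjugate points of the contour add up to. -/
noncomputable def pairedResolvent (T : A) (z u : ℂ) : A :=
  Ring.inverse (quadratic z T) * ((2 * (conj z * u).re) • (1 : A) - (2 * u.re) • T)

theorem pairedResolvent_mem_bicommutant (T : A) (z u : ℂ) :
    pairedResolvent T z u ∈ bicommutant T :=
  mul_mem (inverse_mem_bicommutant (quadratic_mem_bicommutant z (self_mem_bicommutant T)))
    (sub_mem (Subalgebra.smul_mem _ (one_mem _) _)
      (Subalgebra.smul_mem _ (self_mem_bicommutant T) _))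

theorem continuous_inverse_quadratic [CompleteSpace A] {T : A} {c : ℂ} {r : ℝ} (hr : 0 ≤ r)
    (hu : ∀ z ∈ Metric.sphere c r, IsUnit (quadratic z T)) :
    Continuous fun θ : ℝ => Ring.inverse (quadratic (circleMap c r θ) T) := by
  refine continuous_iff_continuousAt.2 fun θ => ?_
  obtain ⟨v, hv⟩ := hu _ (circleMap_mem_sphere c hr θ)
  have h1 := NormedRing.inverse_continuousAt v
  rw [hv] at h1
  refine ContinuousAt.comp (f := fun θ : ℝ => quadratic (circleMap c r θ) T) h1 ?_
  have h2 := continuous_circleMap c r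
  unfold quadratic
  fun_prop

/-- Partial fractions: the numerator z̄u + zū - (u + ū)w is u(z̄ - w) + ū(z - w). Writing ū/(z̄ - w)
as a conjugate leaves two Cauchy kernels on the same circle, with poles w and w̄. -/
theorem character_pairedResolvent {T : A} {z u : ℂ} (hu : IsUnit (quadratic z T))
    (χ : bicommutant T →ₐ[ℝ] ℂ) {w : ℂ} (hw : w = χ ⟨T, self_mem_bicommutant T⟩) :
    χ ⟨pairedResolvent T z u, pairedResolvent_mem_bicommutant T z u⟩
      = u / (z - w) + conj (u / (z - conj w)) := by
  have h1 : (⟨quadratic z T, quadratic_mem_bicommutant z (self_mem_bicommutant T)⟩ :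
      bicommutant T) * ⟨pairedResolvent T z u, pairedResolvent_mem_bicommutant T z u⟩
      = (2 * (conj z * u).re) • (1 : bicommutant T)
        - (2 * u.re) • ⟨T, self_mem_bicommutant T⟩ :=
    Subtype.ext (Ring.mul_inverse_cancel_left _ _ hu)
  have h2 := congrArg χ h1
  have h3 : χ ⟨quadratic z T, quadratic_mem_bicommutant z (self_mem_bicommutant T)⟩
      = (z - w) * (conj z - w) := by
    rw [hw]
    exact character_quadratic z ⟨T, self_mem_bicommutant T⟩ χ
  have h4 : (z - w) * (conj z - w) ≠ 0 := by
    rw [← h3]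
    exact character_apply_ne_zero _ hu χ
  have h5 : ((2 * (conj z * u).re : ℝ) : ℂ) = conj z * u + z * conj u := by
    rw [← Complex.add_conj, map_mul, Complex.conj_conj]
  have h6 : ((2 * u.re : ℝ) : ℂ) = u + conj u := (Complex.add_conj u).symm
  rw [map_mul, map_sub, map_smul, map_smul, map_one, ← hw, h3, Complex.real_smul,
    Complex.real_smul, h5, h6] at h2
  have h7 := left_ne_zero_of_mul h4
  have h8 := right_ne_zero_of_mul h4
  rw [map_div₀, map_sub, Complex.conj_conj, div_add_div _ _ h7 h8, eq_div_iff h4, mul_comm, h2]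
  ring

/-- The integral is taken inside the bicommutant, which is complete, so the inclusion and every
continuous character can be moved under the integral sign. -/
theorem exists_character_integral_pairedResolvent [CompleteSpace A] (T : A) {c : ℂ} {r : ℝ}
    (hr : 0 ≤ r) (hu : ∀ z ∈ Metric.sphere c r, IsUnit (quadratic z T)) :
    ∃ S : bicommutant T,
      (S : A) = ∫ θ in (0 : ℝ)..(2 * π), pairedResolvent T (circleMap c r θ) (circleMap 0 r θ) ∧
      ∀ χ : bicommutant T →ₐ[ℝ] ℂ, Continuous χ → ∀ w, w = χ ⟨T, self_mem_bicommutant T⟩ →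
        χ S = (∫ θ in (0 : ℝ)..(2 * π), circleMap 0 r θ / (circleMap c r θ - w))
          + conj (∫ θ in (0 : ℝ)..(2 * π), circleMap 0 r θ / (circleMap c r θ - conj w)) := by
  have hc := continuous_circleMap c r
  have hc0 := continuous_circleMap 0 r
  have hcont : Continuous fun θ : ℝ =>
      (⟨pairedResolvent T (circleMap c r θ) (circleMap 0 r θ),
        pairedResolvent_mem_bicommutant T _ _⟩ : bicommutant T) := by
    refine Continuous.subtype_mk ?_ _
    unfold pairedResolvent
    have h := continuous_inverse_quadratic hr hu
    fun_prop
  refine ⟨∫ θ in (0 : ℝ)..(2 * π), ⟨_, pairedResolvent_mem_bicommutant T (circleMap c r θ)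
    (circleMap 0 r θ)⟩, ?_, ?_⟩
  · exact (ContinuousLinearMap.intervalIntegral_comp_comm
      (⟨(bicommutant T).val.toLinearMap, continuous_subtype_val⟩ : bicommutant T →L[ℝ] A)
      (hcont.intervalIntegrable 0 (2 * π))).symm
  · intro χ hχ w hw
    -- A pole on the contour would make `quadratic` non-invertible at a point of the circle.
    have hne : ∀ v : ℂ, v = w ∨ conj v = w → ∀ θ, circleMap c r θ - v ≠ 0 := by
      intro v hv θ h
      rw [sub_eq_zero] at h
      refine not_isUnit_quadratic_of_character χ (z := v) ?_
        (h ▸ hu _ (circleMap_mem_sphere c hr θ))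
      rwa [← hw]
    have h1 := ContinuousLinearMap.intervalIntegral_comp_comm (μ := MeasureTheory.volume)
      (⟨χ.toLinearMap, hχ⟩ : bicommutant T →L[ℝ] ℂ) (hcont.intervalIntegrable 0 (2 * π))
    refine h1.symm.trans ?_
    rw [← intervalIntegral.intervalIntegral_conj, ← intervalIntegral.integral_add]
    · congr 1
      ext θ
      exact character_pairedResolvent (hu _ (circleMap_mem_sphere c hr θ)) χ hw
    · exact (hc0.div (hc.sub continuous_const) (hne w (Or.inl rfl))).intervalIntegrable _ _
    · exact (Complex.continuous_conj.comp (hc0.div (hc.sub continuous_const)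
        (hne (conj w) (Or.inr (Complex.conj_conj w))))).intervalIntegrable _ _

end Algebra

/-! ### Pairing the integrals over conjugate circles -/

variable {ι V : Type*} [NormedAddCommGroup V] [NormedSpace ℝ V]
  [Module ℍ[ℝ]ᵐᵒᵖ V] [IsScalarTower ℝ ℍ[ℝ]ᵐᵒᵖ V]

theorem pseudo_slicePoint {I : ℍ[ℝ]} (hI : I ∈ imagUnits) (z : ℂ) (T : BddOp V) :
    pseudo (slicePoint I z) T = quadratic z T := by
  rw [pseudo, slicePoint_re hI, norm_slicePoint hI, quadratic]

theorem pseudo_eq_quadratic {I : ℍ[ℝ]} (hI : I ∈ imagUnits) (q : ℍ[ℝ]) (T : BddOp V) :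
    pseudo q T = quadratic ⟨q.re, ‖q.im‖⟩ T := by
  obtain ⟨J, hJ, h⟩ := exists_eq_slicePoint q hI
  rw [← pseudo_slicePoint hJ, ← h]

variable [RightInnerProductSpace V] [CompleteSpace V]

section

variable (b : QuatHilbertBasis ι V) (T : BddOp V) {I : ℍ[ℝ]} (hI : I ∈ imagUnits)

include hI

/-- With dp = (p - c) I dθ, the factor -dp I is (p - c) dθ. The left multiplications stay to the
right of `T`, as they need not commute with it. -/
theorem leftSResolvent_mul_leftMul (c : ℂ) (r θ : ℝ) :
    leftSResolvent b (slicePoint I (circleMap c r θ)) T *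
        b.leftMul (-(slicePoint I (deriv (circleMap c r) θ)) * I)
      = Ring.inverse (quadratic (circleMap c r θ) T) *
        (b.leftMulHom (sliceHom hI (conj (circleMap c r θ) * circleMap 0 r θ))
          - T * b.leftMulHom (sliceHom hI (circleMap 0 r θ))) := by
  have h : -(slicePoint I (deriv (circleMap c r) θ)) * I = sliceHom hI (circleMap 0 r θ) := by
    calc _ = -(sliceHom hI (deriv (circleMap c r) θ)) * sliceHom hI Complex.I := by
          rw [sliceHom_apply, sliceHom_apply, slicePoint_I]
      _ = _ := by
          rw [← map_neg, ← map_mul, deriv_circleMap, neg_mul, mul_assoc, Complex.I_mul_I,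
            mul_neg_one, neg_neg]
  rw [h, leftSResolvent, star_slicePoint hI, ← sliceHom_apply hI (conj _), ← b.leftMulHom_apply,
    ← b.leftMulHom_apply, map_mul, map_mul, pseudo_slicePoint hI]
  exact neg_mul_sub_mul _ _ _ _

theorem leftMulHom_add_conj (u : ℂ) :
    b.leftMulHom (sliceHom hI u) + b.leftMulHom (sliceHom hI (conj u))
      = (2 * u.re) • (1 : BddOp V) := by
  rw [← map_add, ← map_add, Complex.add_conj, ← Algebra.algebraMap_eq_smul_one]
  exact (b.leftMulHom.comp (sliceHom hI)).commutes _

theorem sResolventCircleIntegral_add_conj {c : ℂ} {r : ℝ} (hr : 0 ≤ r)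
    (hu : ∀ z ∈ Metric.sphere c r, IsUnit (quadratic z T)) :
    sResolventCircleIntegral b T I c r + sResolventCircleIntegral b T I (conj c) r
      = ∫ θ in (0 : ℝ)..(2 * π), pairedResolvent T (circleMap c r θ) (circleMap 0 r θ) := by
  have hL : Continuous fun z => b.leftMulHom (sliceHom hI z) := by
    refine b.continuous_leftMulHom.comp ?_
    exact (continuous_slicePoint I).congr fun z => (sliceHom_apply hI z).symm
  have hc := continuous_circleMap c r
  have hc0 := continuous_circleMap 0 r
  have hK := continuous_inverse_quadratic hr hu
  have hconj := Complex.continuous_conj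
  have h2 : sResolventCircleIntegral b T I (conj c) r
      = ∫ θ in (0 : ℝ)..(2 * π), Ring.inverse (quadratic (circleMap c r θ) T) *
        (b.leftMulHom (sliceHom hI (conj (conj (circleMap c r θ) * circleMap 0 r θ)))
          - T * b.leftMulHom (sliceHom hI (conj (circleMap 0 r θ)))) := by
    -- The substitution θ ↦ 2π - θ runs through the second circle at the conjugates of the points of
    -- the first.
    have h3 := intervalIntegral.integral_comp_sub_left (a := 0) (b := 2 * π)
      (fun θ => leftSResolvent b (slicePoint I (circleMap (conj c) r θ)) T *
        b.leftMul (-(slicePoint I (deriv (circleMap (conj c) r) θ)) * I)) (2 * π)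
    rw [sub_self, sub_zero] at h3
    rw [sResolventCircleIntegral, ← h3]
    congr 1
    ext1 θ
    have h4 := circleMap_conj 0 r θ
    rw [map_zero] at h4
    rw [leftSResolvent_mul_leftMul b T hI, circleMap_conj, h4, quadratic_conj,
      map_mul (starRingEnd ℂ)]
  rw [h2, sResolventCircleIntegral]
  simp only [leftSResolvent_mul_leftMul b T hI]
  rw [← intervalIntegral.integral_add]
  · congr 1
    ext1 θ
    rw [pairedResolvent, ← leftMulHom_add_conj b hI, ← mul_add, sub_add_sub_comm, ← mul_add,
      leftMulHom_add_conj]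
    congr 2
    exact (congrArg (T * ·) (leftMulHom_add_conj b hI _)).trans (mul_smul_one_eq _ T)
  · refine Continuous.intervalIntegrable ?_ _ _
    exact hK.mul ((hL.comp (by fun_prop)).sub (continuous_const.mul (hL.comp (by fun_prop))))
  · refine Continuous.intervalIntegrable ?_ _ _
    exact hK.mul ((hL.comp (by fun_prop)).sub (continuous_const.mul (hL.comp (by fun_prop))))

end

end QuatOp

namespace QuatOp

open Real ComplexConjugate

/-! ### Consequences of the character values of the projection -/

section Algebra

variable {A : Type*} [NormedRing A] [NormedAlgebra ℝ A] {T : A}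

theorem character_smul (χ : bicommutant T →ₐ[ℝ] ℂ) (r : ℝ) (x : bicommutant T) :
    χ (r • x) = r * χ x := by
  rw [map_smul, Complex.real_smul]

/-- An element of the bicommutant that all characters annihilate has `{0}` as its spectrum. -/
theorem isUnit_quadratic_iff_of_character_eq_zero
    (hdet : ∀ x : bicommutant T, ¬ IsUnit (x : A) →
      ∃ χ : bicommutant T →ₐ[ℝ] ℂ, Continuous χ ∧ χ x = 0)
    (N : bicommutant T) (hN : ∀ χ : bicommutant T →ₐ[ℝ] ℂ, Continuous χ → χ N = 0)
    (hex : ∃ χ : bicommutant T →ₐ[ℝ] ℂ, Continuous χ) (z : ℂ) :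
    IsUnit (quadratic z (N : A)) ↔ z ≠ 0 := by
  constructor
  · rintro h rfl
    obtain ⟨χ, hχ⟩ := hex
    refine character_apply_ne_zero ⟨_, quadratic_mem_bicommutant 0 N.2⟩ h χ ?_
    rw [character_quadratic, hN χ hχ]
    simp
  · intro hz
    by_contra h
    obtain ⟨χ, hχ, h0⟩ := hdet ⟨_, quadratic_mem_bicommutant z N.2⟩ h
    rw [character_quadratic, hN χ hχ, sub_zero, sub_zero] at h0
    simp [hz] at h0

/-- The conclusions about `quadratic c T` and an element `P` of the bicommutant whose values at the
characters are those of the indicator function of the zero set of `quadratic c T`. -/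
theorem isUnit_and_isUnit_quadratic_iff {c : ℂ}
    (hdet : ∀ x : bicommutant T, ¬ IsUnit (x : A) →
      ∃ χ : bicommutant T →ₐ[ℝ] ℂ, Continuous χ ∧ χ x = 0)
    (hT : ¬ IsUnit (quadratic c T)) (P : bicommutant T)
    (hP : ∀ χ : bicommutant T →ₐ[ℝ] ℂ, Continuous χ → ∀ w, w = χ ⟨T, self_mem_bicommutant T⟩ →
      χ P = if w = c ∨ w = conj c then 1 else 0) :
    (IsUnit (quadratic c T + P) ∧
      IsUnit (quadratic c T + ((2 : ℝ) • T + (1 - 2 * c.re) • (1 : A)) * P)) ∧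
    ((∀ z, IsUnit (quadratic z (quadratic c T * P)) ↔ z ≠ 0) ∧
      ∀ z, IsUnit (quadratic z
        (quadratic c T * ((2 : ℝ) • T + (1 - 2 * c.re) • (1 : A)) * P)) ↔ z ≠ 0) := by
  let t : bicommutant T := ⟨T, self_mem_bicommutant T⟩
  let Q : bicommutant T := ⟨quadratic c T, quadratic_mem_bicommutant c t.2⟩
  let D : bicommutant T := (2 : ℝ) • t + (1 - 2 * c.re) • (1 : bicommutant T)
  have hQ : ∀ χ : bicommutant T →ₐ[ℝ] ℂ, χ Q = (c - χ t) * (conj c - χ t) := fun χ =>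
    character_quadratic c t χ
  have hD : ∀ χ : bicommutant T →ₐ[ℝ] ℂ, χ D = 2 * χ t + (1 - 2 * c.re) := fun χ => by
    change χ ((2 : ℝ) • t + (1 - 2 * c.re) • (1 : bicommutant T)) = _
    rw [map_add, map_smul, map_smul, map_one, Complex.real_smul, Complex.real_smul]
    push_cast
    ring
  have hQP : ∀ χ : bicommutant T →ₐ[ℝ] ℂ, Continuous χ →
      (χ Q = 0 ∧ χ P = 1 ∧ χ D ≠ 0) ∨ (χ Q ≠ 0 ∧ χ P = 0) := by
    intro χ hχ
    have hPχ := hP χ hχ _ rfl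
    by_cases h : χ t = c ∨ χ t = conj c
    · refine Or.inl ⟨?_, by rw [hPχ, if_pos h], ?_⟩
      · rw [hQ]
        rcases h with h | h <;> simp [h]
      · rw [hD]
        intro h0
        -- At χ(T) = c or c̄ the value is 1 ± 2i Im c, with real part 1.
        have h1 := congrArg Complex.re h0
        rcases h with h | h <;> simp [h] at h1
    · refine Or.inr ⟨?_, by rw [hPχ, if_neg h]⟩
      rw [not_or] at h
      rw [hQ]
      exact mul_ne_zero (sub_ne_zero.2 (Ne.symm h.1)) (sub_ne_zero.2 (Ne.symm h.2))
  -- Some character exists because `quadratic c T` is not invertible; this puts 0 into the spectra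
  -- of the products.
  have hex : ∃ χ : bicommutant T →ₐ[ℝ] ℂ, Continuous χ := by
    obtain ⟨χ, hχ, -⟩ := hdet Q hT
    exact ⟨χ, hχ⟩
  refine ⟨⟨?_, ?_⟩, ?_, ?_⟩
  · by_contra h
    obtain ⟨χ, hχ, h0⟩ := hdet (Q + P) h
    rw [map_add] at h0
    rcases hQP χ hχ with ⟨h1, h2, -⟩ | ⟨h1, h2⟩ <;> simp [h1, h2] at h0
  · by_contra h
    obtain ⟨χ, hχ, h0⟩ := hdet (Q + D * P) h
    rw [map_add, map_mul] at h0
    rcases hQP χ hχ with ⟨h1, h2, h3⟩ | ⟨h1, h2⟩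
    · simp [h1, h2, h3] at h0
    · simp [h1, h2] at h0
  · refine isUnit_quadratic_iff_of_character_eq_zero hdet (Q * P) (fun χ hχ => ?_) hex
    rw [map_mul]
    rcases hQP χ hχ with ⟨h1, h2, -⟩ | ⟨h1, h2⟩ <;> simp [h1, h2]
  · refine isUnit_quadratic_iff_of_character_eq_zero hdet (Q * D * P) (fun χ hχ => ?_) hex
    rw [map_mul, map_mul]
    rcases hQP χ hχ with ⟨h1, h2, -⟩ | ⟨h1, h2⟩ <;> simp [h1, h2]

end Algebra

/-! ### Evaluation of the Riesz projection at the characters -/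

theorem conj_notMem_closedBall {c : ℂ} {r : ℝ} (hc : r < |c.im|) :
    conj c ∉ Metric.closedBall c r := by
  intro h
  rw [Metric.mem_closedBall, Complex.dist_conj_self] at h
  have := abs_nonneg c.im
  linarith

/-- The Cauchy integrals of `1 / (z - w)` over the contour given by two conjugate circles: the
value at a point `w` is one of two, according to whether `w` is one of the centers. -/
theorem integral_add_conj_integral {c w : ℂ} {r : ℝ} (hr : 0 < r) (hc : c.im ≠ 0 → r < |c.im|)
    (hw : ∀ v, v = w ∨ v = conj w → v ∈ Metric.closedBall c r → v = c ∨ v = conj c) :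
    (∫ θ in (0 : ℝ)..(2 * π), circleMap 0 r θ / (circleMap c r θ - w))
        + conj (∫ θ in (0 : ℝ)..(2 * π), circleMap 0 r θ / (circleMap c r θ - conj w))
      = if w = c ∨ w = conj c then (if c.im = 0 then (4 * π : ℂ) else 2 * π) else 0 := by
  have hmem : c ∈ Metric.ball c r := Metric.mem_ball_self hr
  have hreal : conj (2 * π : ℂ) = 2 * π := by rw [map_mul, Complex.conj_ofReal, map_ofNat]
  split_ifs with h h0
  -- For a real center both integrals contribute 2π.
  · have hcc : conj c = c := Complex.conj_eq_iff_im.2 h0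
    have hwc : w = c := by rcases h with h | h <;> simp [h, hcc]
    rw [hwc, hcc, integral_circleMap_div_sub_of_mem hmem, hreal]
    ring
  -- For a nonreal center c̄ is outside the disc, so exactly one integral contributes.
  · have hn := conj_notMem_closedBall (hc h0)
    rcases h with rfl | rfl
    · rw [integral_circleMap_div_sub_of_mem hmem, integral_circleMap_div_sub_of_notMem hr.le hn,
        map_zero, add_zero]
    · rw [Complex.conj_conj, integral_circleMap_div_sub_of_mem hmem,
        integral_circleMap_div_sub_of_notMem hr.le hn, hreal, zero_add]
  · have h1 : w ∉ Metric.closedBall c r := fun hm => h (hw w (Or.inl rfl) hm)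
    have h2 : conj w ∉ Metric.closedBall c r := fun hm => by
      rcases hw (conj w) (Or.inr rfl) hm with h3 | h3
      · exact h (Or.inr (by rw [← h3, Complex.conj_conj]))
      · exact h (Or.inl ((starRingEnd ℂ).injective h3))
    rw [integral_circleMap_div_sub_of_notMem hr.le h1,
      integral_circleMap_div_sub_of_notMem hr.le h2, map_zero, add_zero]

variable {ι V : Type*} [NormedAddCommGroup V] [NormedSpace ℝ V]
  [Module ℍ[ℝ]ᵐᵒᵖ V] [IsScalarTower ℝ ℍ[ℝ]ᵐᵒᵖ V]

theorem isQuasiNilpotent_of_quadratic {I : ℍ[ℝ]} (hI : I ∈ imagUnits) {N : BddOp V}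
    (h : ∀ z, IsUnit (quadratic z N) ↔ z ≠ 0) : IsQuasiNilpotent N := by
  ext p
  rw [sSpectrum, Set.mem_ofPred_eq, pseudo_eq_quadratic hI, h, not_not, Set.mem_singleton_iff,
    Complex.ext_iff]
  constructor
  · rintro ⟨h1, h2⟩
    have h3 : p.im = 0 := norm_eq_zero.1 h2
    rw [← Quaternion.re_add_im p, h3]
    simp only [Complex.zero_re] at h1
    simp [h1]
  · rintro rfl
    simp

/-- The points of the disc of a separating radius that lie in the `S`-spectrum are centers. -/
theorem IsSeparatingRadius.eq_or_eq_conj {T : BddOp V} {q I : ℍ[ℝ]} {ε : ℝ}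
    (hε : IsSeparatingRadius T q ε) (hI : I ∈ imagUnits) {z : ℂ}
    (hz : z ∈ Metric.closedBall (⟨q.re, ‖q.im‖⟩ : ℂ) ε) (hT : ¬ IsUnit (quadratic z T)) :
    z = ⟨q.re, ‖q.im‖⟩ ∨ z = conj (⟨q.re, ‖q.im‖⟩ : ℂ) := by
  obtain ⟨J, hJ, hq⟩ := exists_eq_slicePoint q hI
  have h1 : slicePoint I z ∈ axialHull (Metric.closedBall q ε) := by
    -- ℂ_J contains q, so the copy of z in ℂ_J is within ε of q; it lies on the same sphere as the
    -- copy in ℂ_I.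
    refine Set.mem_biUnion (x := slicePoint J z) ?_ ?_
    · rw [Metric.mem_closedBall, dist_eq_norm] at hz ⊢
      rw [hq, ← sliceHom_apply hJ, ← sliceHom_apply hJ, ← map_sub, sliceHom_apply,
        norm_slicePoint hJ]
      exact hz
    · rw [slicePoint_mem_sphere_iff hI, slicePoint_re hJ, slicePoint_im z hJ, norm_mul,
        norm_imagUnit hJ]
      simp
  have h2 : slicePoint I z ∈ sSpectrum T := by
    rwa [sSpectrum, Set.mem_ofPred_eq, pseudo_slicePoint hI]
  have h3 : slicePoint I z ∈ sphere q := hε.2.2 ▸ ⟨h1, h2⟩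
  rw [slicePoint_mem_sphere_iff hI] at h3
  rcases (abs_eq (norm_nonneg _)).1 h3.2 with h4 | h4
  · exact Or.inl (Complex.ext h3.1 h4)
  · exact Or.inr (Complex.ext h3.1 h4)

/-- Spectral points in the closed disc are at distance 0 or 2‖Im q‖ from the center. Neither equals
ε: if q is not real, ε < ‖Im q‖. -/
theorem IsSeparatingRadius.isUnit_quadratic {T : BddOp V} {q I : ℍ[ℝ]} {ε : ℝ}
    (hε : IsSeparatingRadius T q ε) (hI : I ∈ imagUnits) {z : ℂ}
    (hz : z ∈ Metric.sphere (⟨q.re, ‖q.im‖⟩ : ℂ) ε) : IsUnit (quadratic z T) := by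
  have hpos := hε.1
  by_contra h
  rw [Metric.mem_sphere] at hz
  rcases hε.eq_or_eq_conj hI (Metric.mem_closedBall.2 hz.le) h with rfl | rfl
  · rw [dist_self] at hz
    exact hpos.ne hz
  · rw [Complex.dist_conj_self, abs_norm] at hz
    by_cases h0 : q.im = 0
    · rw [h0, norm_zero, mul_zero] at hz
      exact hpos.ne hz
    · have := hε.2.1 h0
      linarith

variable [RightInnerProductSpace V] [CompleteSpace V]

/-- For real q the two centers coincide and the sum over the `Finset` has one term. Counting that
circle twice and halving the constant gives the same paired form in both cases. -/
theorem rieszProjection_eq (b : QuatHilbertBasis ι V) (T : BddOp V) (q I : ℍ[ℝ]) (ε : ℝ) :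
    rieszProjection b T q I ε
      = (if ‖q.im‖ = 0 then 1 / (4 * π) else 1 / (2 * π)) •
        (sResolventCircleIntegral b T I ⟨q.re, ‖q.im‖⟩ ε
          + sResolventCircleIntegral b T I (conj (⟨q.re, ‖q.im‖⟩ : ℂ)) ε) := by
  have hc : conj (⟨q.re, ‖q.im‖⟩ : ℂ) = ⟨q.re, -‖q.im‖⟩ := rfl
  rw [rieszProjection, hc]
  split_ifs with h
  · rw [h, neg_zero, Finset.pair_eq_singleton, Finset.sum_singleton, ← two_smul ℝ, smul_smul]
    congr 1
    field_simp
    norm_num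
  · rw [Finset.sum_pair]
    intro h1
    have h2 := congrArg Complex.im h1
    simp only at h2
    exact h (by linarith)

/-- The Riesz projection lies in the bicommutant of `T`, and its values at the characters are those
of the indicator function of `[q]`. -/
theorem exists_character_rieszProjection (b : QuatHilbertBasis ι V) {T : BddOp V} {q I : ℍ[ℝ]}
    (hI : I ∈ imagUnits) {ε : ℝ} (hε : IsSeparatingRadius T q ε) :
    ∃ P : bicommutant T, (P : BddOp V) = rieszProjection b T q I ε ∧
      ∀ χ : bicommutant T →ₐ[ℝ] ℂ, Continuous χ → ∀ w, w = χ ⟨T, self_mem_bicommutant T⟩ →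
        χ P = if w = ⟨q.re, ‖q.im‖⟩ ∨ w = conj (⟨q.re, ‖q.im‖⟩ : ℂ) then 1 else 0 := by
  have hu : ∀ z ∈ Metric.sphere (⟨q.re, ‖q.im‖⟩ : ℂ) ε, IsUnit (quadratic z T) :=
    fun z hz => hε.isUnit_quadratic hI hz
  obtain ⟨S, hS, hχS⟩ := exists_character_integral_pairedResolvent T hε.1.le hu
  refine ⟨(if ‖q.im‖ = 0 then 1 / (4 * π) else 1 / (2 * π) : ℝ) • S, ?_, ?_⟩
  · rw [rieszProjection_eq, sResolventCircleIntegral_add_conj b T hI hε.1.le hu, ← hS]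
    rfl
  · intro χ hχ w hw
    have hpi : (π : ℂ) ≠ 0 := Complex.ofReal_ne_zero.2 Real.pi_ne_zero
    rw [character_smul, hχS χ hχ w hw, integral_add_conj_integral hε.1]
    · simp only
      split_ifs
      · push_cast
        field_simp
      · rw [mul_zero]
      · push_cast
        field_simp
      · rw [mul_zero]
    · intro h
      rw [abs_norm]
      exact hε.2.1 (norm_ne_zero_iff.1 h)
    · intro v hv hm
      refine hε.eq_or_eq_conj hI hm (not_isUnit_quadratic_of_character χ ?_)
      rw [← hw]
      rcases hv with rfl | rfl
      · exact Or.inl rfl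
      · exact Or.inr (Complex.conj_conj w)

end QuatOp

theorem proposition3p7 {ι V : Type*} [NormedAddCommGroup V] [NormedSpace ℝ V]
    [Module ℍ[ℝ]ᵐᵒᵖ V] [IsScalarTower ℝ ℍ[ℝ]ᵐᵒᵖ V] [QuatOp.RightInnerProductSpace V]
    [CompleteSpace V] (b : QuatOp.QuatHilbertBasis ι V)
    (T : QuatOp.BddOp V) (q : ℍ[ℝ]) (hq : QuatOp.IsIsolatedSphere T q)
    (I : ℍ[ℝ]) (hI : I ∈ QuatOp.imagUnits) (ε : ℝ) (hε : QuatOp.IsSeparatingRadius T q ε)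
    (P : QuatOp.BddOp V) (hP : P = QuatOp.rieszProjection b T q I ε) :
    (IsUnit (QuatOp.pseudo q T + P) ∧
      IsUnit (QuatOp.pseudo q T
        + ((2 : ℝ) • T + (1 - 2 * q.re) • (1 : QuatOp.BddOp V)) * P)) ∧
    (QuatOp.IsQuasiNilpotent (QuatOp.pseudo q T * P) ∧
      QuatOp.IsQuasiNilpotent (QuatOp.pseudo q T
        * ((2 : ℝ) • T + (1 - 2 * q.re) • (1 : QuatOp.BddOp V)) * P)) := by
  obtain ⟨J, hJ, hqJ⟩ := QuatOp.exists_eq_slicePoint q hI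
  have hqT : ¬ IsUnit (QuatOp.quadratic ⟨q.re, ‖q.im‖⟩ T) := by
    rw [← QuatOp.pseudo_eq_quadratic hI]
    exact hq.1 ⟨J, hJ, hqJ⟩
  obtain ⟨R, hR, hχ⟩ := QuatOp.exists_character_rieszProjection b hI hε
  obtain ⟨h1, h2, h3⟩ := QuatOp.isUnit_and_isUnit_quadratic_iff
    (fun x hx => QuatOp.exists_character_apply_eq_zero hI _ (QuatOp.bicommutant_comm T) x hx)
    hqT R hχ
  rw [hR, ← hP, ← QuatOp.pseudo_eq_quadratic hI] at h1 h2 h3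
  exact ⟨h1, QuatOp.isQuasiNilpotent_of_quadratic hI h2,
    QuatOp.isQuasiNilpotent_of_quadratic hI h3⟩
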